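/- Let $g \in \mathbb{R}[X,Y]$ be a non-zero polynomial of total degree $d$, let $f \in \mathbb{R}[X,Y]$, and let $U \subseteq \mathbb{R}^2$ be an open set. Consider the solutions $(x,y) \in U$ of the system $f(x,y) = 0$, $g(x,y) = 0$, each counted once (without multiplicity). 1. If $f$ is non-zero of total degree $\delta$ and the number of solutions in $U$ is finite, then this number is at most $\dfrac{d^2}{4} + d\delta$. 2. If $f$ is the zero polynomial, then the number of solutions in $U$ (that is, the number of zeros of $g$ in $U$) is either infinite or at most $d^2$. -/

import Mathlib

/-- The set of real solutions of the system `f(X,Y) = 0`, `g(X,Y) = 0` lying in `U ⊆ ℝ²`. -/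
def realSolutions (f g : MvPolynomial (Fin 2) ℝ) (U : Set (Fin 2 → ℝ)) : Set (Fin 2 → ℝ) :=
  {p | p ∈ U ∧ MvPolynomial.eval p f = 0 ∧ MvPolynomial.eval p g = 0}

open MvPolynomial

/-! Split `g` into prime factors `p` and bound each one's share of the zeros. If `p ∤ f`, Bézout
gives at most `deg p * deg f`. If `p ∣ f`, the zeros of `p` in `U` are isolated. An isolated real
zero is critical, since otherwise `p` changes sign there, so Bézout applies to `p` and a nonzero
partial derivative. Summing gives `d * δ` for `f ≠ 0` and `d ^ 2` for `f = 0`; the term `d ^ 2 / 4`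
is slack. -/

/-! ### Affine Bézout by dimension count -/

theorem two_mul_finrank_restrictTotalDegree_fin_two (K : Type*) [Field K] (k : ℕ) :
    2 * Module.finrank K (restrictTotalDegree (Fin 2) K k) = (k + 1) * (k + 2) := by
  have h : {n : Fin 2 →₀ ℕ | (n.sum fun _ e => e) ≤ k} =
      (((Finset.range (k + 1)).sigma fun i => Finset.range (i + 1)).image
        fun x : (_ : ℕ) × ℕ => (Finsupp.single 0 x.2 + Finsupp.single 1 (x.1 - x.2) :
          Fin 2 →₀ ℕ) : Finset (Fin 2 →₀ ℕ)) := by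
    ext n
    have hn : (n.sum fun _ e => e) = n 0 + n 1 := by
      rw [Finsupp.sum_fintype _ _ (by simp), Fin.sum_univ_two]
    simp only [Set.mem_ofPred_eq, hn, Finset.coe_image, Set.mem_image, Finset.mem_coe,
      Finset.mem_sigma, Finset.mem_range, Sigma.exists]
    constructor
    · intro h
      refine ⟨n 0 + n 1, n 0, by omega, ?_⟩
      ext i
      fin_cases i <;> simp
    · rintro ⟨a, b, hab, rfl⟩
      simp
      omega
  have hc : Module.finrank K (restrictTotalDegree (Fin 2) K k) =
      ∑ i ∈ Finset.range (k + 1), (i + 1) := by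
    rw [restrictTotalDegree, Module.finrank_eq_nat_card_basis (basisRestrictSupport K _),
      Nat.card_coe_set_eq, h, Set.ncard_coe_finset, Finset.card_image_of_injOn,
      Finset.card_sigma]
    · simp
    · rintro ⟨a, b⟩ hx ⟨c, d⟩ hy hxy
      simp only [Finset.coe_sigma, Set.mem_sigma_iff, Finset.mem_coe, Finset.mem_range] at hx hy
      have h0 := DFunLike.congr_fun hxy 0
      have h1 := DFunLike.congr_fun hxy 1
      simp at h0 h1
      obtain rfl : b = d := h0
      obtain rfl : a = c := by omega
      rfl
  rw [hc]
  clear hc h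
  induction k with
  | zero => simp
  | succ k ih => rw [Finset.sum_range_succ, mul_add, ih]; ring

/-- Interpolation: an indicator polynomial of a point in a finite set. -/
theorem exists_totalDegree_le_card_eval_eq_zero {σ K : Type*} [Field K]
    (S : Finset (σ → K)) (s : σ → K) (hs : s ∉ S) :
    ∃ P : MvPolynomial σ K, P.totalDegree ≤ S.card ∧ eval s P ≠ 0 ∧ ∀ t ∈ S, eval t P = 0 := by
  classical
  have h : ∀ t ∈ S, ∃ i, s i ≠ t i := fun t ht =>
    Function.ne_iff.mp fun e => hs (e ▸ ht)
  choose i hi using h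
  refine ⟨∏ t : S, (X (i t t.2) - C ((t : σ → K) (i t t.2))), ?_, ?_, ?_⟩
  · refine (totalDegree_finsetProd _ _).trans ?_
    rw [← Fintype.card_coe, Fintype.card_eq_sum_ones]
    refine Finset.sum_le_sum fun t _ => ?_
    refine (totalDegree_sub _ _).trans ?_
    simp [totalDegree_X]
  · simp only [map_prod, map_sub, eval_X, eval_C]
    exact Finset.prod_ne_zero_iff.mpr fun t ht => sub_ne_zero.mpr (hi t t.2)
  · intro t ht
    rw [map_prod]
    exact Finset.prod_eq_zero (Finset.mem_univ ⟨t, ht⟩) (by simp)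

/-- The restriction of polynomial functions to a finite set. -/
noncomputable def evalOnFinset {σ K : Type*} [Field K] (S : Finset (σ → K)) :
    MvPolynomial σ K →ₗ[K] (S → K) :=
  LinearMap.pi fun s => (aeval (s : σ → K)).toLinearMap

@[simp]
theorem evalOnFinset_apply {σ K : Type*} [Field K] (S : Finset (σ → K)) (P : MvPolynomial σ K)
    (s : S) : evalOnFinset S P s = eval (s : σ → K) P := by
  simp [evalOnFinset]

theorem evalOnFinset_domRestrict_surjective {σ K : Type*} [Field K] (S : Finset (σ → K)) {k : ℕ}
    (hk : S.card ≤ k) :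
    Function.Surjective ((evalOnFinset S).domRestrict (restrictTotalDegree σ K k)) := by
  classical
  rw [← LinearMap.range_eq_top, eq_top_iff, ← (Pi.basisFun K S).span_eq, Submodule.span_le]
  rintro _ ⟨s, rfl⟩
  obtain ⟨P, hP, hs, ht⟩ := exists_totalDegree_le_card_eval_eq_zero (S.erase s) (s : σ → K)
    (Finset.notMem_erase _ _)
  have hPk : P ∈ restrictTotalDegree σ K k := by
    rw [mem_restrictTotalDegree]
    exact hP.trans ((Finset.card_erase_le).trans hk)
  refine ⟨(eval (s : σ → K) P)⁻¹ • ⟨P, hPk⟩, ?_⟩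
  ext t
  rw [map_smul, Pi.smul_apply, LinearMap.domRestrict_apply, evalOnFinset_apply,
    Pi.basisFun_apply, smul_eq_mul]
  by_cases hst : t = s
  · subst hst
    simp [hs]
  · rw [ht t (by simp [Subtype.coe_injective.ne hst]), Pi.single_eq_of_ne hst, mul_zero]

/-- The multiples of `p` by polynomials of degree at most `k`. -/
noncomputable abbrev mulRestrictTotalDegree {σ K : Type*} [Field K] (p : MvPolynomial σ K)
    (k : ℕ) : Submodule K (MvPolynomial σ K) :=
  (restrictTotalDegree σ K k).map (LinearMap.mulLeft K p)

theorem finrank_mulRestrictTotalDegree {σ K : Type*} [Field K] {p : MvPolynomial σ K}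
    (hp : p ≠ 0) (k : ℕ) :
    Module.finrank K (mulRestrictTotalDegree p k) =
      Module.finrank K (restrictTotalDegree σ K k) :=
  (Submodule.equivMapOfInjective _ (mul_right_injective₀ hp) _).finrank_eq.symm

/-- If `p * a = q * b`, coprimality forces `p ∣ b`, and the cofactor loses `deg p` in degree. This
caps the overlap, hence bounds the dimension of the sum from below. -/
theorem mulRestrictTotalDegree_inf_le {σ K : Type*} [Field K] {p q : MvPolynomial σ K}
    (hp : p ≠ 0) (hpq : IsRelPrime p q) {k l N : ℕ} (hl : l ≤ p.totalDegree + N) :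
    mulRestrictTotalDegree p k ⊓ mulRestrictTotalDegree q l ≤
      mulRestrictTotalDegree (p * q) N := by
  rintro _ ⟨⟨a, -, rfl⟩, b, hb, hab⟩
  simp only [LinearMap.mulLeft_apply] at hab ⊢
  obtain ⟨c, rfl⟩ : p ∣ b := hpq.dvd_of_dvd_mul_left (hab ▸ dvd_mul_right p a)
  refine ⟨c, ?_, ?_⟩
  · by_cases hc : c = 0
    · simp [hc]
    rw [SetLike.mem_coe, mem_restrictTotalDegree] at hb ⊢
    rw [totalDegree_mul_of_isDomain hp hc] at hb
    omega
  · rw [LinearMap.mulLeft_apply, ← hab]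
    ring

/-- A weak form of Bézout's theorem in the affine plane. -/
theorem card_le_totalDegree_mul_totalDegree {K : Type*} [Field K]
    {p q : MvPolynomial (Fin 2) K} (hp : p ≠ 0) (hq : q ≠ 0) (hpq : IsRelPrime p q)
    (S : Finset (Fin 2 → K)) (hSp : ∀ s ∈ S, eval s p = 0) (hSq : ∀ s ∈ S, eval s q = 0) :
    S.card ≤ p.totalDegree * q.totalDegree := by
  set m := p.totalDegree with hm
  set n := q.totalDegree with hn
  set N := S.card with hN
  -- Degree at least `N` makes evaluation on `S` surjective, so its kernel has codimension `N`; the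
  -- extra `m + n` leaves room for the multiples of `p` and `q` inside that kernel.
  set V := restrictTotalDegree (Fin 2) K (m + n + N) with hV
  set L := (evalOnFinset S).domRestrict V with hL
  have hrank : N + Module.finrank K (LinearMap.ker L) = Module.finrank K V := by
    rw [← LinearMap.finrank_range_add_finrank_ker L,
      LinearMap.range_eq_top.mpr (evalOnFinset_domRestrict_surjective S (by omega)), finrank_top]
    simp [hN]
  have hmul : ∀ {r : MvPolynomial (Fin 2) K} {l : ℕ}, (∀ s ∈ S, eval s r = 0) →
      r.totalDegree + l ≤ m + n + N →
      mulRestrictTotalDegree r l ≤ (LinearMap.ker L).map V.subtype := by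
    rintro r l hr hl _ ⟨a, ha, rfl⟩
    rw [SetLike.mem_coe, mem_restrictTotalDegree] at ha
    have hV' : r * a ∈ V := by
      rw [hV, mem_restrictTotalDegree]
      exact (totalDegree_mul _ _).trans (by omega)
    refine ⟨⟨r * a, hV'⟩, ?_, rfl⟩
    rw [SetLike.mem_coe, LinearMap.mem_ker]
    ext s
    rw [hL, LinearMap.domRestrict_apply, evalOnFinset_apply, map_mul, hr s s.2]
    simp
  have hsup : Module.finrank K
      (mulRestrictTotalDegree p (n + N) ⊔ mulRestrictTotalDegree q (m + N) :
        Submodule K (MvPolynomial (Fin 2) K)) ≤ Module.finrank K (LinearMap.ker L) := by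
    refine (Submodule.finrank_mono (sup_le (hmul hSp (by omega)) (hmul hSq (by omega)))).trans ?_
    exact (Submodule.equivMapOfInjective V.subtype V.injective_subtype
      (LinearMap.ker L)).finrank_eq.ge
  have hinf := Submodule.finrank_mono
    (mulRestrictTotalDegree_inf_le hp hpq (k := n + N) (l := m + N) le_rfl)
  have hdim := Submodule.finrank_sup_add_finrank_inf_eq
    (mulRestrictTotalDegree p (n + N)) (mulRestrictTotalDegree q (m + N))
  rw [finrank_mulRestrictTotalDegree (mul_ne_zero hp hq)] at hinf
  rw [finrank_mulRestrictTotalDegree hp, finrank_mulRestrictTotalDegree hq] at hdim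
  have h1 := two_mul_finrank_restrictTotalDegree_fin_two K (m + n + N)
  have h2 := two_mul_finrank_restrictTotalDegree_fin_two K (n + N)
  have h3 := two_mul_finrank_restrictTotalDegree_fin_two K (m + N)
  have h4 := two_mul_finrank_restrictTotalDegree_fin_two K N
  -- With `T k = (k + 1) * (k + 2) / 2`, the codimension bound is `T (m+n+N) - T (n+N) - T (m+N) + T
  -- N = m * n`.
  nlinarith

/-! ### Partial derivatives and isolated real zeros -/

theorem totalDegree_pderiv_lt {σ R : Type*} [CommSemiring R] {p : MvPolynomial σ R} {i : σ}
    (h : pderiv i p ≠ 0) : (pderiv i p).totalDegree < p.totalDegree := by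
  classical
  have key : ∀ b ∈ (pderiv i p).support, (b.sum fun _ e => e) < p.totalDegree := by
    intro b hb
    rw [p.as_sum, map_sum] at hb
    obtain ⟨v, hv, hbv⟩ := Finset.mem_biUnion.mp (support_sum hb)
    rw [pderiv_monomial] at hbv
    have hb' : b = v - Finsupp.single i 1 := by
      simpa using support_monomial_subset hbv
    have hvi : v i ≠ 0 := by
      intro h0
      simp [h0] at hbv
    have hle : Finsupp.single i 1 ≤ v := by
      rw [Finsupp.single_le_iff]
      omega
    have hsum : v.degree = b.degree + 1 := by
      conv_lhs => rw [← tsub_add_cancel_of_le hle, ← hb']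
      simp
    have hvd : (v.sum fun _ e => e) ≤ p.totalDegree := le_totalDegree hv
    change b.degree < _
    change v.degree ≤ _ at hvd
    omega
  obtain ⟨b, hb⟩ := support_nonempty.mpr h
  rw [totalDegree, Finset.sup_lt_iff (lt_of_le_of_lt (Nat.zero_le _) (key b hb))]
  exact key

theorem coeff_X_mul_pderiv {σ R : Type*} [CommSemiring R] (p : MvPolynomial σ R) (i : σ)
    (v : σ →₀ ℕ) : coeff v (X i * pderiv i p) = v i * coeff v p := by
  classical
  induction p using MvPolynomial.induction_on' with
  | monomial u a =>
    rw [X_mul_pderiv_monomial, coeff_smul, coeff_monomial]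
    split_ifs with h
    · simp [h]
    · simp
  | add p q hp hq => rw [map_add, mul_add, coeff_add, hp, hq, coeff_add, mul_add]

theorem exists_pderiv_ne_zero {σ R : Type*} [CommSemiring R] [NoZeroDivisors R] [CharZero R]
    {p : MvPolynomial σ R} (hp : p.totalDegree ≠ 0) : ∃ i, pderiv i p ≠ 0 := by
  by_contra! h
  apply hp
  rw [totalDegree_eq_zero_iff]
  intro v hv i
  by_contra hvi
  have hc := coeff_X_mul_pderiv p i v
  rw [h i, mul_zero, coeff_zero, eq_comm, mul_eq_zero, Nat.cast_eq_zero] at hc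
  exact hc.elim hvi (mem_support_iff.mp hv)

theorem hasDerivAt_eval_update {σ : Type*} [DecidableEq σ] (p : MvPolynomial σ ℝ) (a : σ → ℝ)
    (i : σ) (t : ℝ) :
    HasDerivAt (fun t => eval (Function.update a i t) p)
      (eval (Function.update a i t) (pderiv i p)) t := by
  induction p using MvPolynomial.induction_on with
  | C r => simpa using hasDerivAt_const t r
  | add p q hp hq => simpa using! hp.add hq
  | mul_X p j hp =>
    have hX : HasDerivAt (fun t => eval (Function.update a i t) (X j : MvPolynomial σ ℝ))
        (eval (Function.update a i t) (pderiv i (X j : MvPolynomial σ ℝ))) t := by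
      by_cases hj : j = i
      · subst hj
        simpa using! hasDerivAt_id t
      · simpa [Function.update_of_ne hj, pderiv_X_of_ne hj] using hasDerivAt_const t (a j)
    simpa [Derivation.leibniz, mul_comm, add_comm] using! hp.mul hX

/-- Otherwise `a` would be a local maximum along direction `i`. Applied to `-p` too, it yields both
signs near `a`. -/
theorem exists_mem_ball_eval_pos {p : MvPolynomial (Fin 2) ℝ} {a : Fin 2 → ℝ} {i : Fin 2}
    (ha : eval a p = 0) (hd : eval a (pderiv i p) ≠ 0) {r : ℝ} (hr : 0 < r) :
    ∃ t, Function.update a i t ∈ Metric.ball a r ∧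
      0 < eval (Function.update a i t) p := by
  by_contra! h
  have hcont : ContinuousAt (fun t => Function.update a i t) (a i) := by fun_prop
  have hball : ∀ᶠ t in nhds (a i), Function.update a i t ∈ Metric.ball a r :=
    hcont.eventually (by simpa using! Metric.ball_mem_nhds a hr)
  have hmax : IsLocalMax (fun t => eval (Function.update a i t) p) (a i) := by
    filter_upwards [hball] with t ht
    simpa [ha] using h t ht
  have := hmax.hasDerivAt_eq_zero (hasDerivAt_eval_update p a i (a i))
  simp at this
  exact hd this

/-- An isolated real zero of a polynomial in two variables is a critical point. -/
theorem eval_pderiv_eq_zero_of_finite {p : MvPolynomial (Fin 2) ℝ} {U : Set (Fin 2 → ℝ)}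
    (hU : IsOpen U) (hfin : {x | x ∈ U ∧ eval x p = 0}.Finite) {a : Fin 2 → ℝ} (haU : a ∈ U)
    (ha : eval a p = 0) (i : Fin 2) : eval a (pderiv i p) = 0 := by
  by_contra hd
  obtain ⟨r, hr, hrU⟩ := Metric.isOpen_iff.mp hU a haU
  obtain ⟨t, ht, htp⟩ := exists_mem_ball_eval_pos ha hd hr
  obtain ⟨t', ht', htp'⟩ := exists_mem_ball_eval_pos (p := -p) (i := i) (by simpa using ha)
    (by simpa using hd) hr
  rw [map_neg, Left.neg_pos_iff] at htp'
  obtain ⟨j, hji⟩ : ∃ j : Fin 2, j ≠ i := exists_ne i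
  have htend : ∀ s : ℝ, Filter.Tendsto
      (fun c => Function.update (Function.update a i s) j c) (nhds (a j))
      (nhds (Function.update a i s)) := fun s => by
    have hcont : ContinuousAt (fun c => Function.update (Function.update a i s) j c) (a j) := by
      fun_prop
    have he : Function.update (Function.update a i s) j (a j) = Function.update a i s := by
      rw [Function.update_eq_self_iff, Function.update_of_ne hji]
    simpa only [ContinuousAt, he] using hcont
  have hp : Continuous fun x => eval x p := continuous_eval p
  -- For every `c` near `a j`, the slice `x j = c` of the ball is connected and meets both signs, so
  -- it contains a zero; the finite zero set would then project onto a neighbourhood of `a j`.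
  refine infinite_of_mem_nhds (a j) ?_ (hfin.image fun x => x j)
  filter_upwards [(htend t).eventually (Metric.isOpen_ball.eventually_mem ht),
    (htend t').eventually (Metric.isOpen_ball.eventually_mem ht'),
    (htend t).eventually (hp.continuousAt.eventually (lt_mem_nhds htp)),
    (htend t').eventually (hp.continuousAt.eventually (gt_mem_nhds htp'))] with c h₁ h₂ h₃ h₄
  have hconv : Convex ℝ (Metric.ball a r ∩ {x | x j = c}) :=
    (convex_ball a r).inter (convex_hyperplane (f := fun x : Fin 2 → ℝ => x j)
      ⟨fun _ _ => rfl, fun _ _ => rfl⟩ c)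
  obtain ⟨x, ⟨hx, hxc⟩, hx0⟩ := hconv.isPreconnected.intermediate_value
    ⟨h₂, Function.update_self ..⟩ ⟨h₁, Function.update_self ..⟩ hp.continuousOn ⟨h₄.le, h₃.le⟩
  exact ⟨x, ⟨hrU hx, hx0⟩, hxc⟩

/-! ### Counting over prime factors -/

theorem ncard_realSolutions_zero_le_of_irreducible {p : MvPolynomial (Fin 2) ℝ}
    (hp : Irreducible p) {U : Set (Fin 2 → ℝ)} (hU : IsOpen U)
    (hfin : {x | x ∈ U ∧ eval x p = 0}.Finite) :
    {x | x ∈ U ∧ eval x p = 0}.ncard ≤ p.totalDegree * p.totalDegree := by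
  have hdeg : p.totalDegree ≠ 0 := fun h0 => by
    obtain ⟨c, rfl⟩ : ∃ c, p = C c := ⟨_, totalDegree_eq_zero_iff_eq_C.mp h0⟩
    have hc : c ≠ 0 := fun h => hp.ne_zero (by simp [h])
    exact hp.not_isUnit (hc.isUnit.map C)
  obtain ⟨i, hi⟩ := exists_pderiv_ne_zero hdeg
  have hlt := totalDegree_pderiv_lt hi
  have hrel : IsRelPrime p (pderiv i p) := (hp.isRelPrime_iff_not_dvd).mpr fun hdvd =>
    absurd (totalDegree_le_of_dvd_of_isDomain hdvd hi) (by omega)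
  rw [Set.ncard_eq_toFinset_card _ hfin]
  refine (card_le_totalDegree_mul_totalDegree hp.ne_zero hi hrel _ ?_ ?_).trans
    (Nat.mul_le_mul_left _ hlt.le)
  · intro s hs
    simp at hs
    exact hs.2
  · intro s hs
    simp at hs
    exact eval_pderiv_eq_zero_of_finite hU hfin hs.1 hs.2 i

theorem ncard_realSolutions_le_of_irreducible {f p : MvPolynomial (Fin 2) ℝ}
    (hp : Irreducible p) {U : Set (Fin 2 → ℝ)} (hU : IsOpen U)
    (hfin : (realSolutions f p U).Finite) {c : ℕ} (hpc : p ∣ f → p.totalDegree ≤ c)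
    (hfc : f.totalDegree ≤ c) :
    (realSolutions f p U).ncard ≤ p.totalDegree * c := by
  by_cases hpf : p ∣ f
  · have heq : realSolutions f p U = {x | x ∈ U ∧ eval x p = 0} := by
      ext x
      refine ⟨fun h => ⟨h.1, h.2.2⟩, fun h => ⟨h.1, ?_, h.2⟩⟩
      obtain ⟨q, rfl⟩ := hpf
      rw [map_mul, h.2, zero_mul]
    rw [heq] at hfin ⊢
    exact (ncard_realSolutions_zero_le_of_irreducible hp hU hfin).trans
      (Nat.mul_le_mul_left _ (hpc hpf))
  · rw [Set.ncard_eq_toFinset_card _ hfin]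
    refine (card_le_totalDegree_mul_totalDegree hp.ne_zero (fun h => hpf (by simp [h]))
      (hp.isRelPrime_iff_not_dvd.mpr hpf) _ ?_ ?_).trans (Nat.mul_le_mul_left _ hfc)
    · intro s hs
      exact ((Set.Finite.mem_toFinset hfin).mp hs).2.2
    · intro s hs
      exact ((Set.Finite.mem_toFinset hfin).mp hs).2.1

theorem realSolutions_mul (f g h : MvPolynomial (Fin 2) ℝ) (U : Set (Fin 2 → ℝ)) :
    realSolutions f (g * h) U = realSolutions f g U ∪ realSolutions f h U := by
  ext x
  simp only [realSolutions, Set.mem_ofPred_eq, Set.mem_union, map_mul, mul_eq_zero]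
  tauto

/-- The uniform bound `c` serves both claims: `deg f` dominates common divisors when `f ≠ 0`, and
`deg g` does when `f = 0`. It stays fixed through the induction, so the degrees of the factors add
up. -/
theorem ncard_realSolutions_le {f g : MvPolynomial (Fin 2) ℝ} (hg : g ≠ 0)
    {U : Set (Fin 2 → ℝ)} (hU : IsOpen U) (hfin : (realSolutions f g U).Finite) {c : ℕ}
    (hgc : ∀ p, p ∣ g → p ∣ f → p.totalDegree ≤ c) (hfc : f.totalDegree ≤ c) :
    (realSolutions f g U).ncard ≤ g.totalDegree * c := by
  induction g using UniqueFactorizationMonoid.induction_on_prime with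
  | h₁ => exact absurd rfl hg
  | h₂ u hu =>
    have : realSolutions f u U = ∅ :=
      Set.eq_empty_iff_forall_notMem.mpr fun x hx => (hu.map (eval x)).ne_zero hx.2.2
    simp [this]
  | h₃ q p hq hp ih =>
    rw [realSolutions_mul] at hfin ⊢
    rw [totalDegree_mul_of_isDomain hp.ne_zero hq, add_mul]
    refine (Set.ncard_union_le _ _).trans (add_le_add ?_ ?_)
    · exact ncard_realSolutions_le_of_irreducible hp.irreducible hU
        (hfin.subset Set.subset_union_left) (hgc p (dvd_mul_right p q)) hfc
    · exact ih hq (hfin.subset Set.subset_union_right)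
        fun r hr => hgc r (hr.trans (dvd_mul_left q p))

theorem mainTheorem4 (f g : MvPolynomial (Fin 2) ℝ) (hg : g ≠ 0)
    (U : Set (Fin 2 → ℝ)) (hU : IsOpen U) :
    (f ≠ 0 → (realSolutions f g U).Finite →
      ((realSolutions f g U).ncard : ℝ) ≤
        (g.totalDegree : ℝ) ^ 2 / 4 + (g.totalDegree : ℝ) * (f.totalDegree : ℝ)) ∧
    (f = 0 → (realSolutions f g U).Infinite ∨
      ((realSolutions f g U).Finite ∧ (realSolutions f g U).ncard ≤ g.totalDegree ^ 2)) := by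
  refine ⟨fun hf hfin => ?_, fun hf => ?_⟩
  · have h := ncard_realSolutions_le hg hU hfin
      (fun p _ hpf => totalDegree_le_of_dvd_of_isDomain hpf hf) le_rfl
    have h' : ((realSolutions f g U).ncard : ℝ) ≤
        (g.totalDegree : ℝ) * (f.totalDegree : ℝ) := by exact_mod_cast h
    linarith [sq_nonneg (g.totalDegree : ℝ)]
  · refine (Set.finite_or_infinite (realSolutions f g U)).symm.imp_right fun hfin => ⟨hfin, ?_⟩
    rw [sq]
    exact ncard_realSolutions_le hg hU hfin
      (fun p hpg _ => totalDegree_le_of_dvd_of_isDomain hpg hg) (by simp [hf])
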